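/- For a complex $p\times q$ matrix $X$, let $\sigma_1(X)\ge\cdots\ge\sigma_{\max\{p,q\}}(X)\ge 0$ denote its singular values, i.e. the nonnegative square roots of the eigenvalues (with multiplicity) of whichever of $XX^*$ and $X^*X$ has the larger size, and let $\|X\|$ denote its spectral norm (its largest singular value). Let $G$ be a complex $p\times k$ matrix and $E$ a complex $p\times \ell$ matrix, put $q=k+\ell$, and let $B=\begin{pmatrix} G & E\end{pmatrix}$ and $\widetilde B=\begin{pmatrix} G & 0\end{pmatrix}$, which are $p\times q$ matrices. Write $\sigma_i=\sigma_i(B)$ and $\widetilde\sigma_i=\sigma_i(\widetilde B)$. Then for $i=1,\dots,\min\{p,q\}$, $$|\sigma_i-\widetilde\sigma_i|\le\frac{2\|E\|^2}{2\widetilde\sigma_i+\sqrt{\widetilde\sigma_i^2+4\|E\|^2}},$$ where the right-hand side is read as $0$ if $E=0$ and $\widetilde\sigma_i=0$. -/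

import Mathlib

/- The norm of a complex matrix is its spectral norm, i.e. the operator norm of the associated
linear map between Euclidean spaces. -/
open scoped Matrix.Norms.L2Operator

/-- The sequence of singular values of a complex matrix, in nonincreasing order and with
multiplicity: `singularValue X i` is the `i`-th one for `i = 1, 2, …`, and it is `0` as soon as
`i` is larger than the number of columns of `X`. (Mathlib counts from `0`; the value at `i = 0`
is not used.) -/
noncomputable def singularValue {m n : Type*} [Fintype m] [Fintype n] [DecidableEq n]
    (X : Matrix m n ℂ) (i : ℕ) : ℝ :=
  (Matrix.toEuclideanLin X).singularValues (i - 1)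

/-! Since $BB^*=GG^*+EE^*$ and $\widetilde B\widetilde B^*=GG^*$, one has $\|\widetilde
B^*x\|^2\le\|B^*x\|^2\le\|\widetilde B^*x\|^2+\|E\|^2\|x\|^2$. Weyl monotonicity
(`singularValues_sq_le_add`) and invariance under adjoints (`singularValues_adjoint`) give
$\widetilde\sigma_i^2\le\sigma_i^2\le\widetilde\sigma_i^2+\|E\|^2$. The rest is the scalar
inequality `abs_sub_le_of_sq_le_sq_add`. -/

namespace LinearMap

open Module

variable {𝕜 : Type*} [RCLike 𝕜]
  {E : Type*} [NormedAddCommGroup E] [InnerProductSpace 𝕜 E] [FiniteDimensional 𝕜 E]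
  {F : Type*} [NormedAddCommGroup F] [InnerProductSpace 𝕜 F] [FiniteDimensional 𝕜 F]
  {F' : Type*} [NormedAddCommGroup F'] [InnerProductSpace 𝕜 F'] [FiniteDimensional 𝕜 F']

/-- An orthonormal basis of right singular vectors. -/
noncomputable abbrev rightSingularBasis (T : E →ₗ[𝕜] F) :
    OrthonormalBasis (Fin (finrank 𝕜 E)) 𝕜 E :=
  T.isSymmetric_adjoint_comp_self.eigenvectorBasis rfl

theorem norm_sq_apply_eq_sum_singularValues (T : E →ₗ[𝕜] F) (x : E) :
    ‖T x‖ ^ 2 = ∑ j : Fin (finrank 𝕜 E), T.singularValues j ^ 2 * ‖T.rightSingularBasis.repr x j‖ ^ 2 := by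
  have h : inner 𝕜 x ((T.adjoint ∘ₗ T) x) = ((‖T x‖ ^ 2 : ℝ) : 𝕜) := by
    rw [LinearMap.comp_apply, LinearMap.adjoint_inner_right, inner_self_eq_norm_sq_to_K]
    simp
  rw [← RCLike.ofReal_inj (K := 𝕜), ← h,
    ← T.rightSingularBasis.repr.inner_map_map, PiLp.inner_apply, RCLike.ofReal_sum]
  refine Finset.sum_congr rfl fun j _ => ?_
  rw [T.isSymmetric_adjoint_comp_self.eigenvectorBasis_apply_self_apply,
    ← T.sq_singularValues_fin rfl, RCLike.inner_apply, mul_assoc, RCLike.mul_conj]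
  push_cast
  rfl

/-- The coordinates in the basis of right singular vectors with index in `s`. -/
noncomputable def singularCoord (T : E →ₗ[𝕜] F) (s : Set (Fin (finrank 𝕜 E))) : E →ₗ[𝕜] (s → 𝕜) :=
  LinearMap.pi fun j => T.rightSingularBasis.toBasis.coord j

theorem mem_ker_singularCoord (T : E →ₗ[𝕜] F) (s : Set (Fin (finrank 𝕜 E))) (x : E) :
    x ∈ ker (T.singularCoord s) ↔ ∀ j ∈ s, T.rightSingularBasis.repr x j = 0 := by
  simp [singularCoord, funext_iff]

/-- One half of Courant–Fischer: `V` is the span of the right singular vectors of index at most `i`.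
-/
theorem exists_submodule_singularValues_sq_mul_le (T : E →ₗ[𝕜] F) {i : ℕ}
    (hi : i < finrank 𝕜 E) :
    ∃ V : Submodule 𝕜 E, i < finrank 𝕜 V ∧
      ∀ x ∈ V, T.singularValues i ^ 2 * ‖x‖ ^ 2 ≤ ‖T x‖ ^ 2 := by
  refine ⟨ker (T.singularCoord (Set.Ioi ⟨i, hi⟩)), ?_, fun x hx => ?_⟩
  · have h1 := (T.singularCoord (Set.Ioi ⟨i, hi⟩)).finrank_range_add_finrank_ker
    have h2 := (range (T.singularCoord (Set.Ioi ⟨i, hi⟩))).finrank_le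
    have h3 : Fintype.card (Set.Ioi (⟨i, hi⟩ : Fin (finrank 𝕜 E))) = finrank 𝕜 E - 1 - i := by
      rw [← Set.toFinset_card, Set.toFinset_Ioi, Fin.card_Ioi]
    rw [finrank_fintype_fun_eq_card, h3] at h2
    omega
  · rw [mem_ker_singularCoord] at hx
    rw [norm_sq_apply_eq_sum_singularValues, ← T.rightSingularBasis.repr.norm_map,
      EuclideanSpace.norm_sq_eq, Finset.mul_sum]
    refine Finset.sum_le_sum fun j _ => ?_
    rcases lt_or_ge (⟨i, hi⟩ : Fin (finrank 𝕜 E)) j with h | h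
    · simp [hx j h]
    · gcongr
      · exact T.singularValues_nonneg _
      · exact T.singularValues_antitone h

/-- The other half: by dimension, `V` meets nontrivially the span of the right singular vectors of
index at least `i`, where $\|Tx\|^2\le\sigma_i^2\|x\|^2$. -/
theorem le_singularValues_sq_of_submodule (T : E →ₗ[𝕜] F) {i : ℕ} {V : Submodule 𝕜 E}
    (hV : i < finrank 𝕜 V) {c : ℝ} (h : ∀ x ∈ V, c * ‖x‖ ^ 2 ≤ ‖T x‖ ^ 2) :
    c ≤ T.singularValues i ^ 2 := by
  have hi : i < finrank 𝕜 E := hV.trans_le V.finrank_le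
  have hlt : finrank 𝕜 (Set.Iio (⟨i, hi⟩ : Fin (finrank 𝕜 E)) → 𝕜) < finrank 𝕜 V := by
    rwa [finrank_fintype_fun_eq_card, ← Set.toFinset_card, Set.toFinset_Iio, Fin.card_Iio]
  obtain ⟨⟨x, hxV⟩, hx, hx0⟩ := Submodule.exists_mem_ne_zero_of_ne_bot
    (ker_ne_bot_of_finrank_lt (f := T.singularCoord (Set.Iio ⟨i, hi⟩) ∘ₗ V.subtype) hlt)
  replace hx : x ∈ ker (T.singularCoord (Set.Iio ⟨i, hi⟩)) := hx
  have hx0 : 0 < ‖x‖ ^ 2 := by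
    have : x ≠ 0 := by simpa using hx0
    positivity
  rw [mem_ker_singularCoord] at hx
  refine le_of_mul_le_mul_right ((h x hxV).trans ?_) hx0
  rw [norm_sq_apply_eq_sum_singularValues, ← T.rightSingularBasis.repr.norm_map,
    EuclideanSpace.norm_sq_eq, Finset.mul_sum]
  refine Finset.sum_le_sum fun j _ => ?_
  rcases lt_or_ge j (⟨i, hi⟩ : Fin (finrank 𝕜 E)) with h | h
  · simp [hx j h]
  · gcongr
    · exact T.singularValues_nonneg _
    · exact T.singularValues_antitone h

/-- Weyl's monotonicity principle for squared singular values. -/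
theorem singularValues_sq_le_add (S : E →ₗ[𝕜] F) (T : E →ₗ[𝕜] F') {c : ℝ} (hc : 0 ≤ c)
    (h : ∀ x, ‖S x‖ ^ 2 ≤ ‖T x‖ ^ 2 + c * ‖x‖ ^ 2) (i : ℕ) :
    S.singularValues i ^ 2 ≤ T.singularValues i ^ 2 + c := by
  rcases lt_or_ge i (finrank 𝕜 E) with hi | hi
  · obtain ⟨V, hV, hS⟩ := S.exists_submodule_singularValues_sq_mul_le hi
    have := T.le_singularValues_sq_of_submodule hV (c := S.singularValues i ^ 2 - c)
      fun x hx => by linarith [hS x hx, h x]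
    linarith
  · simpa [S.singularValues_of_finrank_le hi, T.singularValues_of_finrank_le hi] using hc

/-- If $\sigma_i>0$, then `T` is injective on the extremal subspace `V`, so `T(V)` is a test space
of the same dimension for the adjoint. -/
theorem singularValues_le_adjoint (T : E →ₗ[𝕜] F) (i : ℕ) :
    T.singularValues i ≤ T.adjoint.singularValues i := by
  rcases (T.singularValues_nonneg i).eq_or_lt with h0 | hpos
  · exact h0 ▸ T.adjoint.singularValues_nonneg i
  have hi : i < finrank 𝕜 E := by
    by_contra hi
    exact hpos.ne' (T.singularValues_of_finrank_le (not_lt.mp hi))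
  obtain ⟨V, hV, hT⟩ := T.exists_submodule_singularValues_sq_mul_le hi
  have hle : ∀ x ∈ V, T.singularValues i * ‖x‖ ≤ ‖T x‖ := fun x hx =>
    le_of_sq_le_sq (by simpa [mul_pow] using hT x hx) (norm_nonneg _)
  have hinj : Function.Injective (T ∘ₗ V.subtype) := by
    rw [injective_iff_map_eq_zero]
    rintro ⟨x, hx⟩ hx0
    replace hx0 : T x = 0 := hx0
    have := hle x hx
    rw [hx0, norm_zero] at this
    simpa using nonpos_of_mul_nonpos_right this hpos
  refine le_of_sq_le_sq (T.adjoint.le_singularValues_sq_of_submodule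
    (V := range (T ∘ₗ V.subtype)) ?_ ?_) (T.adjoint.singularValues_nonneg i)
  · rwa [finrank_range_of_inj hinj]
  · rintro _ ⟨⟨x, hx⟩, rfl⟩
    change T.singularValues i ^ 2 * ‖T x‖ ^ 2 ≤ ‖T.adjoint (T x)‖ ^ 2
    -- Cauchy–Schwarz for $\langle x,T^*Tx\rangle=\|Tx\|^2$.
    have hCS : ‖T x‖ ^ 2 ≤ ‖x‖ * ‖T.adjoint (T x)‖ := by
      have h := norm_inner_le_norm (𝕜 := 𝕜) x (T.adjoint (T x))
      rwa [adjoint_inner_right, inner_self_eq_norm_sq_to_K, norm_pow, RCLike.norm_ofReal,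
        abs_norm] at h
    rw [← mul_pow]
    gcongr
    rcases (norm_nonneg (T x)).eq_or_lt with h0 | h0
    · rw [← h0, mul_zero]
      exact norm_nonneg _
    · refine le_of_mul_le_mul_left ?_ h0
      nlinarith [hle x hx, norm_nonneg (T.adjoint (T x))]

theorem singularValues_adjoint (T : E →ₗ[𝕜] F) : T.adjoint.singularValues = T.singularValues := by
  ext i
  refine le_antisymm ?_ (T.singularValues_le_adjoint i)
  simpa using T.adjoint.singularValues_le_adjoint i

end LinearMap

open Matrix

theorem singularValue_conjTranspose {m n : Type*} [Fintype m] [Fintype n] [DecidableEq m]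
    [DecidableEq n] (X : Matrix m n ℂ) (i : ℕ) : singularValue Xᴴ i = singularValue X i := by
  rw [singularValue, singularValue, toEuclideanLin_conjTranspose_eq_adjoint,
    LinearMap.singularValues_adjoint]

theorem norm_sq_conjTranspose_fromCols_apply {m n₁ n₂ : Type*} [Fintype m] [Fintype n₁]
    [Fintype n₂] [DecidableEq m] (A : Matrix m n₁ ℂ) (B : Matrix m n₂ ℂ)
    (x : EuclideanSpace ℂ m) :
    ‖(fromCols A B)ᴴ.toEuclideanLin x‖ ^ 2 =
      ‖Aᴴ.toEuclideanLin x‖ ^ 2 + ‖Bᴴ.toEuclideanLin x‖ ^ 2 := by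
  simp [conjTranspose_fromCols_eq_fromRows_conjTranspose, EuclideanSpace.norm_sq_eq,
    toLpLin_apply, fromRows_mulVec]

theorem abs_sub_le_of_sq_le_sq_add {s t e : ℝ} (hs : 0 ≤ s) (ht : 0 ≤ t)
    (hts : t ^ 2 ≤ s ^ 2) (hst : s ^ 2 ≤ t ^ 2 + e ^ 2) :
    |s - t| ≤ 2 * e ^ 2 / (2 * t + √(t ^ 2 + 4 * e ^ 2)) := by
  have hts' : t ≤ s := le_of_sq_le_sq hts hs
  rw [abs_of_nonneg (sub_nonneg.mpr hts')]
  set r := √(t ^ 2 + 4 * e ^ 2) with hr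
  have hr0 : 0 ≤ r := Real.sqrt_nonneg _
  have hr2 : r ^ 2 = t ^ 2 + 4 * e ^ 2 := Real.sq_sqrt (by positivity)
  -- A zero denominator forces `t = e = 0`, hence `s = 0`.
  rcases (show 0 ≤ 2 * t + r by positivity).eq_or_lt with h | h
  · have ht0 : t = 0 := by linarith
    have hr0' : r = 0 := by linarith
    rw [← h, div_zero]
    nlinarith
  · rw [le_div_iff₀ h]
    -- If `r ≤ 2s`, then $(s-t)(2t+r)\le2(s^2-t^2)\le2e^2$; otherwise $2(s-t)(2t+r)\le
    -- r^2-4t^2\le4e^2$.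
    rcases le_or_gt r (2 * s) with h' | h'
    · nlinarith [mul_le_mul_of_nonneg_left h' (sub_nonneg.mpr hts')]
    · nlinarith [mul_le_mul_of_nonneg_right h'.le h.le, sq_nonneg t]

theorem theorem4 (p k l : ℕ) (G : Matrix (Fin p) (Fin k) ℂ) (E : Matrix (Fin p) (Fin l) ℂ)
    (i : ℕ) (hi₁ : 1 ≤ i) (hi₂ : i ≤ min p (k + l)) :
    |singularValue (Matrix.fromCols G E) i -
        singularValue (Matrix.fromCols G (0 : Matrix (Fin p) (Fin l) ℂ)) i| ≤
      2 * ‖E‖ ^ 2 /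
        (2 * singularValue (Matrix.fromCols G (0 : Matrix (Fin p) (Fin l) ℂ)) i +
          Real.sqrt (singularValue (Matrix.fromCols G (0 : Matrix (Fin p) (Fin l) ℂ)) i ^ 2 +
            4 * ‖E‖ ^ 2)) := by
  have hS : ∀ {X : Matrix (Fin p) (Fin k ⊕ Fin l) ℂ}, 0 ≤ singularValue X i :=
    LinearMap.singularValues_nonneg _ _
  refine abs_sub_le_of_sq_le_sq_add hS hS ?_ ?_
  · rw [← singularValue_conjTranspose, ← singularValue_conjTranspose (fromCols G E)]
    refine (LinearMap.singularValues_sq_le_add _ _ le_rfl (fun x => ?_) (i - 1)).trans_eq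
      (add_zero _)
    simp [norm_sq_conjTranspose_fromCols_apply]
  · rw [← singularValue_conjTranspose, ← singularValue_conjTranspose (fromCols G 0)]
    refine LinearMap.singularValues_sq_le_add _ _ (sq_nonneg ‖E‖) (fun x => ?_) (i - 1)
    have h : ‖Eᴴ.toEuclideanLin x‖ ≤ ‖E‖ * ‖x‖ := by
      rw [← l2_opNorm_conjTranspose]
      exact l2_opNorm_mulVec Eᴴ x
    rw [norm_sq_conjTranspose_fromCols_apply, norm_sq_conjTranspose_fromCols_apply, ← mul_pow]
    simpa using pow_le_pow_left₀ (norm_nonneg _) h 2
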